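/- **Theorem 2.** Let $I$ and $J$ be compact Hausdorff spaces, and let $f : I \times J \to \mathbb{C}$ be a bounded, separately continuous function (i.e. $f(i,\cdot)$ is continuous on $J$ for every $i \in I$ and $f(\cdot,j)$ is continuous on $I$ for every $j \in J$). Then the "matrix" $f$ is weakly compact. That is, $f$ has the following properties (which are equivalent to each other for every bounded complex function on a product of two sets): 1. (Fubini-like property) For a set $S$ let $\ell^\infty(S)$ be the Banach space of bounded complex functions on $S$ with the sup-norm, and call a positive linear functional on $\ell^\infty(S)$ taking the constant $1$ to $1$ a mean. For every mean $M$ on $\ell^\infty(I)$ and every mean $N$ on $\ell^\infty(J)$, $$M\bigl(i \mapsto N(f(i,\cdot))\bigr) = N\bigl(j \mapsto M(f(\cdot,j))\bigr).$$ 2. There are compact convex subsets $\tilde I$, $\tilde J$ of Hausdorff locally convex topological linear spaces, injections of sets $I \to \tilde I$, $J \to \tilde J$, and a function $\tilde f : \tilde I \times \tilde J \to \mathbb{C}$ that is continuous and affine in each of its variables separately and extends $f$ (when $I$ and $J$ are regarded as subsets of $\tilde I$ and $\tilde J$). 3. The set of rows $\{f(i,\cdot) : i \in I\}$ is weakly relatively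 compact in $\ell^\infty(J)$. 4. The set of columns $\{f(\cdot,j) : j \in J\}$ is weakly relatively compact in $\ell^\infty(I)$. -/

import Mathlib

universe u v

open scoped ComplexOrder

noncomputable section

namespace WeakMatrix

/-- The Banach space `ℓ^∞(S)` of bounded complex functions on a set `S`, with the sup-norm. -/
abbrev LInf (S : Type u) : Type u := lp (fun _ : S => ℂ) ⊤

/-- A matrix, i.e. a complex function on `I × J`, is bounded. -/
def IsBounded {I : Type u} {J : Type v} (f : I → J → ℂ) : Prop :=
  ∃ C : ℝ, ∀ i j, ‖f i j‖ ≤ C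

/-- A bounded complex function, as an element of `ℓ^∞`. -/
def toLInf {S : Type u} (g : S → ℂ) (hg : ∃ C : ℝ, ∀ s, ‖g s‖ ≤ C) : LInf S :=
  ⟨g, memℓp_infty (by
    obtain ⟨C, hC⟩ := hg
    exact ⟨C, by rintro _ ⟨s, rfl⟩; exact hC s⟩)⟩

@[simp] theorem toLInf_apply {S : Type u} (g : S → ℂ) (hg : ∃ C : ℝ, ∀ s, ‖g s‖ ≤ C) (s : S) :
    toLInf g hg s = g s := rfl

/-- The row `f(i, •)`, an element of `ℓ^∞(J)`. -/
def row {I : Type u} {J : Type v} (f : I → J → ℂ) (hf : IsBounded f) (i : I) : LInf J :=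
  toLInf (fun j => f i j) (hf.imp fun _ h => h i)

/-- The column `f(•, j)`, an element of `ℓ^∞(I)`. -/
def col {I : Type u} {J : Type v} (f : I → J → ℂ) (hf : IsBounded f) (j : J) : LInf I :=
  toLInf (fun i => f i j) (hf.imp fun _ h i => h i j)

/-- The constant function `1` in `ℓ^∞(S)`. -/
def oneLInf (S : Type u) : LInf S := toLInf (fun _ => 1) ⟨1, fun _ => by simp⟩

/-- A mean on `ℓ^∞(S)`: a positive linear functional taking the constant `1` to `1`.
(The order on `ℂ` is the one in which `0 ≤ z` means that `z` is real and nonnegative.) -/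
structure IsMean {S : Type u} (M : LInf S →ₗ[ℂ] ℂ) : Prop where
  nonneg : ∀ g : LInf S, (∀ s, 0 ≤ g s) → 0 ≤ M g
  map_one : M (oneLInf S) = 1

/-- A mean is bounded on a real-valued function by any bound of that function. -/
theorem IsMean.norm_apply_le_of_real {S : Type u} {M : LInf S →ₗ[ℂ] ℂ} (hM : IsMean M)
    (g : LInf S) (r : S → ℝ) (hr : ∀ s, g s = r s) (C : ℝ) (hC : ∀ s, |r s| ≤ C) :
    ‖M g‖ ≤ C := by
  have h1 : 0 ≤ M ((C : ℂ) • oneLInf S - g) := hM.nonneg _ fun s => by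
    have h : ((C : ℂ) • oneLInf S - g : LInf S) s = ((C - r s : ℝ) : ℂ) := by
      change (C : ℂ) * 1 - g s = _
      rw [hr]
      push_cast
      ring
    rw [h]
    exact Complex.zero_le_real.2 (sub_nonneg.2 (abs_le.1 (hC s)).2)
  have h2 : 0 ≤ M ((C : ℂ) • oneLInf S + g) := hM.nonneg _ fun s => by
    have h : ((C : ℂ) • oneLInf S + g : LInf S) s = ((C + r s : ℝ) : ℂ) := by
      change (C : ℂ) * 1 + g s = _
      rw [hr]
      push_cast
      ring
    rw [h]
    have := (abs_le.1 (hC s)).1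
    exact Complex.zero_le_real.2 (by linarith)
  rw [map_sub, map_smul, hM.map_one, Complex.le_def] at h1
  rw [map_add, map_smul, hM.map_one, Complex.le_def] at h2
  simp at h1 h2
  have h3 : M g = ((M g).re : ℂ) := Complex.ext (by simp) (by simp [← h2.2])
  rw [h3, Complex.norm_real, Real.norm_eq_abs, abs_le]
  constructor <;> linarith [h1.1, h2.1]

/-- A mean is automatically a bounded functional. -/
theorem IsMean.norm_apply_le {S : Type u} {M : LInf S →ₗ[ℂ] ℂ} (hM : IsMean M)
    (g : LInf S) (C : ℝ) (hC : ∀ s, ‖g s‖ ≤ C) : ‖M g‖ ≤ C + C := by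
  have hre : ∀ s, |(g s).re| ≤ C := fun s => (Complex.abs_re_le_norm _).trans (hC s)
  have him : ∀ s, |(g s).im| ≤ C := fun s => (Complex.abs_im_le_norm _).trans (hC s)
  let a : LInf S := toLInf (fun s => ((g s).re : ℂ)) ⟨C, fun s => by simpa using hre s⟩
  let b : LInf S := toLInf (fun s => ((g s).im : ℂ)) ⟨C, fun s => by simpa using him s⟩
  have hg : g = a + Complex.I • b := by
    ext s
    change g s = ((g s).re : ℂ) + Complex.I * ((g s).im : ℂ)
    rw [mul_comm, Complex.re_add_im]
  have ha : ‖M a‖ ≤ C := hM.norm_apply_le_of_real a (fun s => (g s).re) (fun _ => rfl) C hre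
  have hb : ‖M b‖ ≤ C := hM.norm_apply_le_of_real b (fun s => (g s).im) (fun _ => rfl) C him
  rw [hg, map_add, map_smul]
  refine (norm_add_le _ _).trans (add_le_add ha ?_)
  simpa using hb

/-- The bounded function `i ↦ N(f(i, •))` on `I`, for a mean `N` on `ℓ^∞(J)`. -/
def meanOfRows {I : Type u} {J : Type v} (f : I → J → ℂ) (hf : IsBounded f)
    (N : LInf J →ₗ[ℂ] ℂ) (hN : IsMean N) : LInf I :=
  toLInf (fun i => N (row f hf i)) (by
    obtain ⟨C, hC⟩ := hf
    exact ⟨C + C, fun i => hN.norm_apply_le _ C fun j => hC i j⟩)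

/-- The bounded function `j ↦ M(f(•, j))` on `J`, for a mean `M` on `ℓ^∞(I)`. -/
def meanOfCols {I : Type u} {J : Type v} (f : I → J → ℂ) (hf : IsBounded f)
    (M : LInf I →ₗ[ℂ] ℂ) (hM : IsMean M) : LInf J :=
  toLInf (fun j => M (col f hf j)) (by
    obtain ⟨C, hC⟩ := hf
    exact ⟨C + C, fun j => hM.norm_apply_le _ C fun i => hC i j⟩)

/-- Fubini-like property: for all means `M` on `ℓ^∞(I)` and `N` on `ℓ^∞(J)`, the iterated integral
of `f` does not depend on the order of integration. -/
def FubiniLike {I : Type u} {J : Type v} (f : I → J → ℂ) (hf : IsBounded f) : Prop :=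
  ∀ (M : LInf I →ₗ[ℂ] ℂ) (hM : IsMean M) (N : LInf J →ₗ[ℂ] ℂ) (hN : IsMean N),
    M (meanOfRows f hf N hN) = N (meanOfCols f hf M hM)

/-- The function `g` is affine on the (convex) set `K`. -/
def IsAffineOn {E : Type u} [AddCommGroup E] [Module ℝ E] (K : Set E) (g : E → ℂ) : Prop :=
  ∀ x ∈ K, ∀ y ∈ K, ∀ s t : ℝ, 0 ≤ s → 0 ≤ t → s + t = 1 →
    g (s • x + t • y) = s • g x + t • g y

/-- `f` extends to a separately continuous (separately) affine function on `K × L`, for some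
injections `a : I → K`, `b : J → L` into compact convex subsets `K`, `L` of Hausdorff locally convex
topological linear spaces `E`, `F`. Only the values of `g` on `K × L` matter. -/
def HasAffineExtension {I : Type u} {J : Type v} (f : I → J → ℂ) : Prop :=
  ∃ (E : Type u) (_ : AddCommGroup E) (_ : Module ℝ E) (_ : TopologicalSpace E)
    (_ : IsTopologicalAddGroup E) (_ : ContinuousSMul ℝ E) (_ : LocallyConvexSpace ℝ E)
    (_ : T2Space E)
    (F : Type v) (_ : AddCommGroup F) (_ : Module ℝ F) (_ : TopologicalSpace F)
    (_ : IsTopologicalAddGroup F) (_ : ContinuousSMul ℝ F) (_ : LocallyConvexSpace ℝ F)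
    (_ : T2Space F)
    (K : Set E) (L : Set F) (a : I → E) (b : J → F) (g : E → F → ℂ),
    IsCompact K ∧ Convex ℝ K ∧ IsCompact L ∧ Convex ℝ L ∧
    Function.Injective a ∧ (∀ i, a i ∈ K) ∧ Function.Injective b ∧ (∀ j, b j ∈ L) ∧
    (∀ i j, g (a i) (b j) = f i j) ∧
    (∀ x ∈ K, ContinuousOn (fun y => g x y) L ∧ IsAffineOn L (fun y => g x y)) ∧
    (∀ y ∈ L, ContinuousOn (fun x => g x y) K ∧ IsAffineOn K (fun x => g x y))

/-- A set in a normed space is weakly relatively compact: its closure in the weak topology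
is compact in the weak topology. -/
def WeaklyRelativelyCompact {X : Type u} [NormedAddCommGroup X] [NormedSpace ℂ X]
    (A : Set X) : Prop :=
  IsCompact (closure (toWeakSpace ℂ X '' A))

/-- A bounded matrix is weakly compact. The notion is given by four conditions that are equivalent
for bounded matrices; all four of them are demanded here. -/
structure IsWeaklyCompact {I : Type u} {J : Type v} (f : I → J → ℂ) (hf : IsBounded f) : Prop where
  fubini : FubiniLike f hf
  affine_extension : HasAffineExtension f
  rows : WeaklyRelativelyCompact (Set.range (row f hf))
  cols : WeaklyRelativelyCompact (Set.range (col f hf))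

end WeakMatrix

end

open Filter Topology MeasureTheory

/-! The core is that for every bounded functional `Φ` the map `j ↦ Φ (f(•, j))` is continuous. If it
failed at a point, some set of bad `j` would accumulate there, and an Eberlein-type double-limit
argument (`exists_seq_tendsto_of_frequently`) extracts a sequence of bad `j` along which the columns
converge pointwise. Dominated convergence makes this convergence weak
(`tendsto_functional_of_pointwise`), a contradiction. So the columns are a weakly continuous image
of a compact space, and the rows likewise by symmetry.

For the Fubini-like property, the means on `ℓ^∞(J)` form a compact space, and `(i, m) ↦ m(f(i, •))`
is again bounded and separately continuous. By the core fact both iterated means depend continuously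
on `m`; they agree on convex combinations of evaluations, which are dense. The affine extension
lives on the two spaces of means, the Fubini-like property giving its regularity in the second
variable. -/

/-! ### Sequential approximation by double limits. -/

theorem exists_finset_uniform_approx {X Y : Type*} [TopologicalSpace X] [CompactSpace X]
    (F : X → Y → ℂ) (hX : ∀ y, Continuous fun x => F x y) (S : Finset Y) {ε : ℝ} (hε : 0 < ε) :
    ∃ D : Finset X, ∀ x, ∃ d ∈ D, ∀ y ∈ S, dist (F d y) (F x y) < ε := by
  obtain ⟨D, -, hD⟩ := (isCompact_univ (X := X)).elim_nhds_subcover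
    (fun d => {x | ∀ y ∈ S, dist (F d y) (F x y) < ε}) (fun d _ => by
      refine (Filter.eventually_all_finset S).2 fun y _ => ?_
      have : Tendsto (fun x => dist (F d y) (F x y)) (𝓝 d) (𝓝 (dist (F d y) (F d y))) :=
        tendsto_const_nhds.dist (hX y).continuousAt
      rw [dist_self] at this
      exact this.eventually (gt_mem_nhds hε))
  refine ⟨D, fun x => ?_⟩
  have := hD (Set.mem_univ x)
  simpa using this

/-- In the range of a separately continuous function on a product of compact spaces, a point of the
closure of a set is, for the topology of pointwise convergence, the limit of a sequence of the
set. -/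
theorem exists_seq_tendsto_of_frequently {X Y : Type*} [TopologicalSpace X] [CompactSpace X]
    [TopologicalSpace Y] [CompactSpace Y] (F : X → Y → ℂ)
    (hX : ∀ y, Continuous fun x => F x y) (hY : ∀ x, Continuous (F x))
    {A : Y → Prop} {y₀ : Y} (hA : ∃ᶠ y in 𝓝 y₀, A y) :
    ∃ u : ℕ → Y, (∀ n, A (u n)) ∧ ∀ x, Tendsto (fun n => F x (u n)) atTop (𝓝 (F x y₀)) := by
  classical
  have hpos : ∀ n : ℕ, (0 : ℝ) < 1 / (n + 1) := fun n => Nat.one_div_pos_of_nat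
  choose D hD using fun (n : ℕ) (S : Finset Y) => exists_finset_uniform_approx F hX S (hpos n)
  have hpick : ∀ (n : ℕ) (T : Finset X),
      ∃ y, A y ∧ ∀ d ∈ T, dist (F d y) (F d y₀) < 1 / (n + 1) := by
    intro n T
    have : ∀ᶠ y in 𝓝 y₀, ∀ d ∈ T, dist (F d y) (F d y₀) < 1 / (n + 1) :=
      (Filter.eventually_all_finset T).2 fun d _ =>
        Metric.tendsto_nhds.1 (hY d).continuousAt _ (hpos n)
    exact (hA.and_eventually this).exists
  choose pick hpickA hpick using hpick
  -- Each new `u n` is close to `y₀` on the test points so far; then test points are added that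
  -- approximate all of `X` on the enlarged finite set. Starting from `y₀` makes the approximation
  -- valid at `y₀` too.
  let st : ℕ → Finset Y × Finset X := fun n => Nat.rec ({y₀}, D 0 {y₀})
    (fun n s => (insert (pick n s.2) s.1, s.2 ∪ D (n + 1) (insert (pick n s.2) s.1))) n
  let u : ℕ → Y := fun n => pick n (st n).2
  have hS : Monotone fun n => (st n).1 := monotone_nat_of_le_succ fun n => Finset.subset_insert _ _
  have hT : Monotone fun n => (st n).2 := monotone_nat_of_le_succ fun n => Finset.subset_union_left
  have hy₀ : ∀ n, y₀ ∈ (st n).1 := fun n => hS (Nat.zero_le n) (Finset.mem_singleton_self y₀)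
  have hu : ∀ k n, k < n → u k ∈ (st n).1 := fun k n h =>
    hS (Nat.succ_le_of_lt h) (Finset.mem_insert_self _ _)
  have hDst : ∀ n, D n (st n).1 ⊆ (st n).2 := by
    rintro (_ | n)
    · exact subset_rfl
    · exact Finset.subset_union_right
  refine ⟨u, fun n => hpickA _ _, fun x => tendsto_iff_ultrafilter _ _ _ |>.2 fun U hU => ?_⟩
  have hlim : Tendsto (fun n : ℕ => (1 : ℝ) / (n + 1)) U (𝓝 0) :=
    tendsto_one_div_add_atTop_nhds_zero_nat.mono_left hU
  choose d hdD hd using fun n => hD n (st n).1 x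
  -- With `y = lim u` and `e = lim d` along `U`, the chain is `F x y = F e y = F e y₀ = F x y₀`.
  obtain ⟨y, -, hy⟩ := isCompact_univ.ultrafilter_le_nhds (U.map u) (by simp)
  obtain ⟨e, -, he⟩ := isCompact_univ.ultrafilter_le_nhds (U.map d) (by simp)
  replace hy : Tendsto u U (𝓝 y) := hy
  replace he : Tendsto d U (𝓝 e) := he
  have hdy : ∀ m, F (d m) y = F (d m) y₀ := fun m => by
    refine tendsto_nhds_unique (((hY (d m)).tendsto y).comp hy) (tendsto_iff_dist_tendsto_zero.2 ?_)
    refine squeeze_zero' (Eventually.of_forall fun _ => dist_nonneg) ?_ hlim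
    filter_upwards [hU (eventually_ge_atTop m)] with n hn
    exact (hpick n _ (d m) (hT hn (hDst m (hdD m)))).le
  have hex : ∀ z, (∃ k, ∀ n, k < n → z ∈ (st n).1) → F e z = F x z := fun z ⟨k, hk⟩ => by
    refine tendsto_nhds_unique (((hX z).tendsto e).comp he) (tendsto_iff_dist_tendsto_zero.2 ?_)
    refine squeeze_zero' (Eventually.of_forall fun _ => dist_nonneg) ?_ hlim
    filter_upwards [hU (eventually_gt_atTop k)] with n hn
    exact (hd n z (hk n hn)).le
  have h1 : F e y = F x y := by
    refine tendsto_nhds_unique (((hY e).tendsto y).comp hy) ?_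
    refine (((hY x).tendsto y).comp hy).congr fun k => (hex (u k) ⟨k, hu k⟩).symm
  have h2 : F e y = F e y₀ := by
    refine tendsto_nhds_unique (((hX y).tendsto e).comp he) ?_
    exact (((hX y₀).tendsto e).comp he).congr fun m => (hdy m).symm
  rw [← hex y₀ ⟨0, fun n _ => hy₀ n⟩, ← h2, h1]
  exact ((hY x).tendsto y).comp hy

/-! ### From pointwise to weak convergence. -/

/-- A positive functional on the continuous functions on a compact space satisfies the dominated
convergence theorem. -/
theorem tendsto_positive_functional_of_pointwise {X : Type*} [TopologicalSpace X] [CompactSpace X]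
    [T2Space X] (Λ : C(X, ℝ) →ₗ[ℝ] ℝ) (hΛ : ∀ g, 0 ≤ g → 0 ≤ Λ g) (g : ℕ → C(X, ℝ)) (C : ℝ)
    (hC : ∀ n x, ‖g n x‖ ≤ C) (hg : ∀ x, Tendsto (fun n => g n x) atTop (𝓝 0)) :
    Tendsto (fun n => Λ (g n)) atTop (𝓝 0) := by
  let _ : MeasurableSpace X := borel X
  have : BorelSpace X := ⟨rfl⟩
  let e : CompactlySupportedContinuousMap X ℝ →ₗ[ℝ] C(X, ℝ) :=
    { toFun := fun h => h.toContinuousMap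
      map_add' := fun _ _ => rfl
      map_smul' := fun _ _ => rfl }
  let P : CompactlySupportedContinuousMap X ℝ →ₚ[ℝ] ℝ :=
    PositiveLinearMap.mk₀ (Λ.comp e) fun h hh => hΛ _ hh
  let μ := RealRMK.rieszMeasure P
  have hint : ∀ n, ∫ x, g n x ∂μ = Λ (g n) := fun n =>
    RealRMK.integral_rieszMeasure P ⟨g n, HasCompactSupport.of_compactSpace _⟩
  have : Tendsto (fun n => ∫ x, g n x ∂μ) atTop (𝓝 (∫ _, 0 ∂μ)) :=
    tendsto_integral_of_dominated_convergence (fun _ => C)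
      (fun n => (g n).continuous.aestronglyMeasurable) (integrable_const C)
      (fun n => Eventually.of_forall (hC n)) (Eventually.of_forall hg)
  simpa [hint] using this

/-- A bounded sequence of continuous functions on a compact space that converges to `0` pointwise
converges to `0` weakly. -/
theorem tendsto_functional_of_pointwise {X : Type*} [TopologicalSpace X] [CompactSpace X]
    [T2Space X] (Φ : C(X, ℂ) →L[ℂ] ℂ) (g : ℕ → C(X, ℂ)) (C : ℝ)
    (hC : ∀ n x, ‖g n x‖ ≤ C) (hg : ∀ x, Tendsto (fun n => g n x) atTop (𝓝 0)) :
    Tendsto (fun n => Φ (g n)) atTop (𝓝 0) := by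
  by_contra hcon
  obtain ⟨ε, hε, hfr⟩ : ∃ ε > 0, ∃ᶠ n in atTop, ε ≤ ‖Φ (g n)‖ := by
    simpa [Metric.tendsto_nhds, Filter.Frequently] using hcon
  obtain ⟨φ, hφ, hφε⟩ := extraction_of_frequently_atTop hfr
  let a : ℕ → C(X, ℝ) := fun n => ⟨fun x => ‖g (φ n) x‖, (g (φ n)).continuous.norm⟩
  -- Chosen so that `‖Φ‖ * δ < ε`: a function of norm at most `δ` cannot have `ε ≤ (Φ h).re`.
  have hδ : 0 < ε / (‖Φ‖ + 1) := by positivity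
  set δ := ε / (‖Φ‖ + 1) with hδdef
  let V : Set C(X, ℝ) := {b | Set.MapsTo b Set.univ (Set.Iio δ)}
  have hVopen : IsOpen V := ContinuousMap.isOpen_setOfPred_mapsTo isCompact_univ isOpen_Iio
  have hVconv : Convex ℝ V := fun b hb c hc s t hs ht hst x hx =>
    convex_Iio δ (hb hx) (hc hx) hs ht hst
  have hhull : convexHull ℝ (Set.range a) ⊆
      {b | ∃ h : C(X, ℂ), (∀ x, ‖h x‖ ≤ b x) ∧ ε ≤ (Φ h).re} := by
    refine convexHull_min ?_ ?_
    · rintro _ ⟨n, rfl⟩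
      obtain ⟨c, hc, hcΦ⟩ : ∃ c : ℂ, ‖c‖ = 1 ∧ c * Φ (g (φ n)) = ‖Φ (g (φ n))‖ := by
        obtain ⟨c, hc, h⟩ := RCLike.exists_norm_mul_eq_self (Φ (g (φ n)))
        have hc0 : c ≠ 0 := fun h0 => by simp [h0] at hc
        refine ⟨c⁻¹, by simp [hc], ?_⟩
        rw [inv_mul_eq_iff_eq_mul₀ hc0]
        exact h.symm
      refine ⟨c • g (φ n), fun x => by simp [a, hc], ?_⟩
      rw [map_smul, smul_eq_mul, hcΦ, Complex.ofReal_re]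
      exact hφε n
    · rintro b ⟨h, hb, hh⟩ b' ⟨h', hb', hh'⟩ s t hs ht hst
      refine ⟨(s : ℂ) • h + (t : ℂ) • h', fun x => ?_, ?_⟩
      · refine (norm_add_le _ _).trans (add_le_add ?_ ?_)
        · simpa [abs_of_nonneg hs] using mul_le_mul_of_nonneg_left (hb x) hs
        · simpa [abs_of_nonneg ht] using mul_le_mul_of_nonneg_left (hb' x) ht
      · rw [map_add, map_smul, map_smul]
        simp only [smul_eq_mul, Complex.add_re, Complex.re_ofReal_mul]
        calc ε = s * ε + t * ε := by rw [← add_mul, hst, one_mul]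
          _ ≤ _ := by gcongr
  have hdisj : Disjoint V (convexHull ℝ (Set.range a)) := by
    refine Set.disjoint_left.2 fun b hbV hb => ?_
    obtain ⟨h, hhb, hΦ⟩ := hhull hb
    have h1 : ‖h‖ ≤ δ := (ContinuousMap.norm_le h hδ.le).2 fun x =>
      (hhb x).trans (hbV (Set.mem_univ x)).le
    have h2 : ε ≤ ‖Φ‖ * δ := (hΦ.trans (Complex.re_le_norm _)).trans
      ((Φ.le_opNorm h).trans (by gcongr))
    have h3 : δ * (‖Φ‖ + 1) = ε := div_mul_cancel₀ _ (by positivity)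
    linarith
  -- Separation replaces `Φ` by a real functional, positive because `V` contains every `b ≤ 0`,
  -- which stays at least `c > 0` on all the `‖g (φ n)‖`; dominated convergence forbids this.
  obtain ⟨Λ, c, hΛV, hΛ⟩ := geometric_hahn_banach_open hVconv hVopen (convex_convexHull ℝ _) hdisj
  have hc : 0 < c := by simpa using hΛV 0 fun x _ => hδ
  have hΛpos : ∀ b : C(X, ℝ), 0 ≤ b → 0 ≤ Λ b := by
    intro b hb
    by_contra! hneg
    have h1 := hΛV ((c / Λ b) • b) fun x _ => by
      have : c / Λ b * b x ≤ 0 := mul_nonpos_of_nonpos_of_nonneg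
        (div_nonpos_of_nonneg_of_nonpos hc.le hneg.le) (hb x)
      exact this.trans_lt hδ
    rw [map_smul, smul_eq_mul, div_mul_cancel₀ _ hneg.ne] at h1
    exact h1.false
  have hlim : Tendsto (fun n => Λ (a n)) atTop (𝓝 0) :=
    tendsto_positive_functional_of_pointwise Λ.toLinearMap hΛpos a C
      (fun n x => by simpa [a] using hC (φ n) x)
      (fun x => by simpa [a] using ((hg x).comp hφ.tendsto_atTop).norm)
  exact hc.not_ge (ge_of_tendsto' hlim fun n =>
    hΛ _ (subset_convexHull ℝ _ (Set.mem_range_self n)))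

/-- Integrating a bounded separately continuous function on a product of compact spaces with
respect to one variable gives a continuous function of the other one. -/
theorem continuous_functional_of_separately_continuous {X Y : Type*} [TopologicalSpace X]
    [CompactSpace X] [T2Space X] [TopologicalSpace Y] [CompactSpace Y] (F : X → Y → ℂ)
    (hX : ∀ y, Continuous fun x => F x y) (hY : ∀ x, Continuous (F x)) (C : ℝ)
    (hC : ∀ x y, ‖F x y‖ ≤ C) (Φ : C(X, ℂ) →L[ℂ] ℂ) :
    Continuous fun y => Φ ⟨fun x => F x y, hX y⟩ := by
  refine continuous_iff_continuousAt.2 fun y₀ => ?_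
  by_contra hcon
  rw [ContinuousAt, Metric.tendsto_nhds] at hcon
  push Not at hcon
  obtain ⟨ε, hε, hfr⟩ := hcon
  obtain ⟨u, hu, hlim⟩ := exists_seq_tendsto_of_frequently F hX hY hfr
  have h := tendsto_functional_of_pointwise Φ
    (fun n => ⟨fun x => F x (u n), hX (u n)⟩ - ⟨fun x => F x y₀, hX y₀⟩) (C + C)
    (fun n x => (norm_sub_le _ _).trans (add_le_add (hC _ _) (hC _ _)))
    (fun x => tendsto_sub_nhds_zero_iff.2 (hlim x))
  refine hε.not_ge (ge_of_tendsto' (by simpa using h.norm) fun n => ?_)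
  simpa [dist_eq_norm] using hu n

/-! ### Weak compactness of the sets of rows and columns. -/

namespace WeakMatrix

theorem norm_toLInf_le {S : Type u} (g : S → ℂ) {C : ℝ} (hC : 0 ≤ C) (h : ∀ s, ‖g s‖ ≤ C) :
    ‖toLInf g ⟨C, h⟩‖ ≤ C :=
  lp.norm_le_of_forall_le hC h

/-- The inclusion of the continuous functions on a compact space into the bounded functions. -/
noncomputable def ofContinuousMap (X : Type u) [TopologicalSpace X] [CompactSpace X] :
    C(X, ℂ) →L[ℂ] LInf X :=
  LinearMap.mkContinuous
    { toFun := fun g => toLInf g ⟨‖g‖, g.norm_coe_le_norm⟩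
      map_add' := fun _ _ => rfl
      map_smul' := fun _ _ => rfl } 1 fun g => by
    rw [one_mul]
    exact norm_toLInf_le g (norm_nonneg g) g.norm_coe_le_norm

theorem continuous_apply_col {X : Type u} {Y : Type v} [TopologicalSpace X] [CompactSpace X]
    [T2Space X] [TopologicalSpace Y] [CompactSpace Y] (F : X → Y → ℂ) (hF : IsBounded F)
    (hX : ∀ y, Continuous fun x => F x y) (hY : ∀ x, Continuous (F x)) (Φ : LInf X →L[ℂ] ℂ) :
    Continuous fun y => Φ (col F hF y) := by
  obtain ⟨C, hC⟩ := id hF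
  exact continuous_functional_of_separately_continuous F hX hY C hC (Φ.comp (ofContinuousMap X))

theorem weaklyRelativelyCompact_range_col {X : Type u} {Y : Type v} [TopologicalSpace X]
    [CompactSpace X] [T2Space X] [TopologicalSpace Y] [CompactSpace Y] (F : X → Y → ℂ)
    (hF : IsBounded F) (hX : ∀ y, Continuous fun x => F x y) (hY : ∀ x, Continuous (F x)) :
    WeaklyRelativelyCompact (Set.range (col F hF)) := by
  have hcont : Continuous fun y => toWeakSpace ℂ (LInf X) (col F hF y) :=
    WeakBilin.continuous_of_continuous_eval _ fun Φ => continuous_apply_col F hF hX hY Φ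
  rw [WeaklyRelativelyCompact, ← Set.range_comp]
  exact (isCompact_range hcont).closure

theorem IsBounded.swap {I : Type u} {J : Type v} {f : I → J → ℂ} (hf : IsBounded f) :
    IsBounded fun j i => f i j :=
  hf.imp fun _ h j i => h i j

theorem norm_apply_le_norm {S : Type u} (g : LInf S) (s : S) : ‖g s‖ ≤ ‖g‖ :=
  lp.norm_apply_le_norm ENNReal.top_ne_zero g s

/-! ### The compact convex space of means. -/

/-- A mean as a continuous functional. -/
noncomputable def IsMean.toCLM {S : Type u} {M : LInf S →ₗ[ℂ] ℂ} (hM : IsMean M) : LInf S →L[ℂ] ℂ :=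
  M.mkContinuous 2 fun g => (hM.norm_apply_le g _ (norm_apply_le_norm g)).trans_eq (two_mul _).symm

/-- The means on `ℓ^∞(S)`, in the space of all functions on `ℓ^∞(S)` with the topology of pointwise
convergence. -/
def means (S : Type u) : Set (LInf S → ℂ) :=
  {m | ∃ M : LInf S →ₗ[ℂ] ℂ, IsMean M ∧ ⇑M = m}

/-- The mean that evaluates at a point. -/
def evalMean {S : Type u} (s : S) : LInf S →ₗ[ℂ] ℂ where
  toFun g := g s
  map_add' _ _ := rfl
  map_smul' _ _ := rfl

theorem isMean_evalMean {S : Type u} (s : S) : IsMean (evalMean s) :=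
  ⟨fun _ hg => hg s, rfl⟩

theorem IsMean.combination {S : Type u} {M N : LInf S →ₗ[ℂ] ℂ} (hM : IsMean M) (hN : IsMean N)
    {s t : ℝ} (hs : 0 ≤ s) (ht : 0 ≤ t) (hst : s + t = 1) :
    IsMean ((s : ℂ) • M + (t : ℂ) • N) where
  nonneg g hg := add_nonneg (mul_nonneg (Complex.zero_le_real.2 hs) (hM.nonneg g hg))
    (mul_nonneg (Complex.zero_le_real.2 ht) (hN.nonneg g hg))
  map_one := by
    simp only [LinearMap.add_apply, LinearMap.smul_apply, hM.map_one, hN.map_one, smul_eq_mul,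
      mul_one]
    exact_mod_cast hst

theorem convex_means (S : Type u) : Convex ℝ (means S) := by
  rintro _ ⟨M, hM, rfl⟩ _ ⟨N, hN, rfl⟩ s t hs ht hst
  exact ⟨_, hM.combination hN hs ht hst, rfl⟩

theorem means_eq (S : Type u) : means S = {m | (∀ g h, m (g + h) = m g + m h) ∧
    (∀ (c : ℂ) (g), m (c • g) = c * m g) ∧ (∀ g : LInf S, (∀ s, 0 ≤ g s) → 0 ≤ m g) ∧
    m (oneLInf S) = 1} := by
  ext m
  constructor
  · rintro ⟨M, hM, rfl⟩
    exact ⟨M.map_add, M.map_smul, hM.nonneg, hM.map_one⟩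
  · rintro ⟨h1, h2, h3, h4⟩
    exact ⟨⟨⟨m, h1⟩, h2⟩, ⟨h3, h4⟩, rfl⟩

theorem isClosed_means (S : Type u) : IsClosed (means S) := by
  rw [means_eq]
  simp only [Set.ofPred_and, Set.ofPred_forall]
  refine .inter (isClosed_iInter fun g => isClosed_iInter fun h => isClosed_eq ?_ ?_)
    (.inter (isClosed_iInter fun c => isClosed_iInter fun g => isClosed_eq ?_ ?_)
      (.inter (isClosed_iInter fun g => isClosed_iInter fun _ => ?_) (isClosed_eq ?_ ?_)))
  on_goal 5 =>
    exact isClosed_le continuous_const (continuous_apply g)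
  all_goals fun_prop

theorem isCompact_means (S : Type u) : IsCompact (means S) := by
  refine (isCompact_univ_pi fun g : LInf S =>
    isCompact_closedBall (0 : ℂ) (‖g‖ + ‖g‖)).of_isClosed_subset
    (isClosed_means S) ?_
  rintro _ ⟨M, hM, rfl⟩ g -
  exact mem_closedBall_zero_iff.2 (hM.norm_apply_le g _ (norm_apply_le_norm g))

/-- The real part of a mean of a function is at least any lower bound of the real part of the
function. -/
theorem IsMean.le_re_apply {S : Type u} {M : LInf S →ₗ[ℂ] ℂ} (hM : IsMean M) (g : LInf S) (c : ℝ)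
    (hc : ∀ s, c ≤ (g s).re) : c ≤ (M g).re := by
  let a : LInf S := toLInf (fun s => ((g s).re : ℂ)) ⟨‖g‖, fun s => by
    simpa using (Complex.abs_re_le_norm _).trans (norm_apply_le_norm g s)⟩
  -- The imaginary part is shifted to be nonnegative, so that its mean is real and contributes
  -- nothing to `(M g).re`.
  let p : LInf S := toLInf (fun s => ((‖g‖ + (g s).im : ℝ) : ℂ)) ⟨‖g‖ + ‖g‖, fun s => by
    rw [Complex.norm_real]
    refine (norm_add_le _ _).trans (add_le_add (by simp) ?_)
    exact (Complex.abs_im_le_norm _).trans (norm_apply_le_norm g s)⟩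
  have hg : g = a + Complex.I • (p - (‖g‖ : ℂ) • oneLInf S) := by
    ext s
    change g s = ((g s).re : ℂ) + Complex.I * (((‖g‖ + (g s).im : ℝ) : ℂ) - (‖g‖ : ℂ) * 1)
    conv_lhs => rw [← Complex.re_add_im (g s)]
    push_cast
    ring
  have ha := hM.nonneg (a - (c : ℂ) • oneLInf S) fun s => by
    change 0 ≤ ((g s).re : ℂ) - (c : ℂ) * 1
    rw [mul_one, ← Complex.ofReal_sub]
    exact Complex.zero_le_real.2 (sub_nonneg.2 (hc s))
  have hp := hM.nonneg p fun s => Complex.zero_le_real.2 <| by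
    have := (abs_le.1 ((Complex.abs_im_le_norm _).trans (norm_apply_le_norm g s))).1
    linarith
  rw [hg]
  simp only [map_sub, map_add, map_smul, hM.map_one, Complex.le_def] at ha hp ⊢
  simp at ha hp ⊢
  linarith [ha.1, hp.2]

/-- A continuous real-linear functional on a power of `ℂ` is the real part of a complex-linear
functional that depends on finitely many coordinates. -/
theorem exists_eq_re_sum {ι : Type*} (φ : (ι → ℂ) →L[ℝ] ℝ) :
    ∃ (t : Finset ι) (c : ι → ℂ), ∀ z, φ z = (∑ i ∈ t, c i * z i).re := by
  classical
  obtain ⟨t, W, hW, htW⟩ : ∃ (t : Finset ι) (W : ι → Set ℂ), (∀ i, W i ∈ 𝓝 0) ∧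
      Set.pi t W ⊆ {z | |φ z| < 1} := by
    have h : {z | |φ z| < 1} ∈ 𝓝 (0 : ι → ℂ) := by
      refine (isOpen_lt (by fun_prop) continuous_const).mem_nhds ?_
      simp
    rw [nhds_pi] at h
    exact Filter.mem_pi'.1 h
  -- All real multiples of such a `z` stay in the neighbourhood, including the one on which `φ`
  -- would be `1`.
  have hzero : ∀ z : ι → ℂ, (∀ i ∈ t, z i = 0) → φ z = 0 := fun z hz => by
    by_contra hne
    have h : (φ z)⁻¹ • z ∈ {z | |φ z| < 1} := htW fun i hi => by
      simpa [hz i hi] using mem_of_mem_nhds (hW i)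
    simp [hne] at h
  refine ⟨t, fun i => φ (Pi.single i (1 : ℂ)) - φ (Pi.single i Complex.I) * Complex.I,
    fun z => ?_⟩
  have hz : φ z = φ (∑ i ∈ t, ((z i).re • Pi.single (M := fun _ => ℂ) i (1 : ℂ) +
      (z i).im • Pi.single (M := fun _ => ℂ) i Complex.I)) := by
    rw [← sub_eq_zero, ← map_sub]
    refine hzero _ fun j hj => ?_
    simp [Finset.sum_apply, Pi.single_apply, hj, Finset.sum_add_distrib, Complex.re_add_im]
  rw [hz, map_sum, Complex.re_sum]
  refine Finset.sum_congr rfl fun i _ => ?_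
  simp
  ring

/-- The finite convex combinations of evaluations are dense in the means. -/
theorem means_subset_closure_convexHull (S : Type u) :
    means S ⊆ closure (convexHull ℝ (Set.range fun s : S => ⇑(evalMean s))) := by
  rintro _ ⟨M, hM, rfl⟩
  by_contra hcon
  obtain ⟨φ, c, hφM, hφ⟩ := geometric_hahn_banach_point_closed (convex_convexHull ℝ _).closure
    isClosed_closure hcon
  obtain ⟨t, a, ha⟩ := exists_eq_re_sum φ
  -- On means, `φ` is the real part of evaluation at one element of `ℓ^∞(S)`, whose real part is
  -- bounded below by `c`.
  have h1 : φ M = (M (∑ g ∈ t, a g • g)).re := by simp [ha]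
  rw [h1] at hφM
  refine hφM.not_ge (hM.le_re_apply _ _ fun s => ?_)
  have h2 : φ (evalMean s) = (evalMean s (∑ g ∈ t, a g • g)).re := by
    simp only [ha, map_sum, map_smul, smul_eq_mul]
  exact ((hφ _ (subset_closure (subset_convexHull ℝ _ (Set.mem_range_self s)))).trans_eq h2).le

/-! ### The Fubini-like property and the affine extension. -/

theorem fubiniLike_of_separately_continuous {I : Type u} {J : Type v}
    [TopologicalSpace I] [CompactSpace I] [T2Space I]
    [TopologicalSpace J] [CompactSpace J] [T2Space J]
    (f : I → J → ℂ) (hf : IsBounded f) (hrow : ∀ i : I, Continuous fun j : J => f i j)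
    (hcol : ∀ j : J, Continuous fun i : I => f i j) : FubiniLike f hf := by
  intro M hM N hN
  have : CompactSpace (means J) := isCompact_iff_compactSpace.1 (isCompact_means J)
  let F : I → means J → ℂ := fun i m => m.1 (row f hf i)
  have hF : IsBounded F := by
    obtain ⟨C, hC⟩ := hf
    refine ⟨C + C, ?_⟩
    rintro i ⟨_, N, hN, rfl⟩
    exact hN.norm_apply_le _ C (hC i)
  -- First use of the core fact, with the variables exchanged; it makes `F` separately continuous,
  -- so that `h1` can use the fact again on `I × means J`.
  have hFI : ∀ m, Continuous fun i => F i m := by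
    rintro ⟨_, N, hN, rfl⟩
    exact continuous_apply_col (fun j i => f i j) hf.swap hrow hcol hN.toCLM
  have hFN : ∀ i, Continuous (F i) := fun i =>
    (continuous_apply (row f hf i)).comp continuous_subtype_val
  have h1 : Continuous fun m : means J => M (col F hF m) :=
    continuous_apply_col F hF hFI hFN hM.toCLM
  have h2 : Continuous fun m : means J => m.1 (meanOfCols f hf M hM) :=
    (continuous_apply _).comp continuous_subtype_val
  let H : Set (LInf J → ℂ) :=
    {m | ∃ N : LInf J →ₗ[ℂ] ℂ, ∃ hN : IsMean N, ⇑N = m ∧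
      M (meanOfRows f hf N hN) = N (meanOfCols f hf M hM)}
  have hH : Convex ℝ H := by
    rintro _ ⟨N, hN, rfl, h⟩ _ ⟨N', hN', rfl, h'⟩ s t hs ht hst
    refine ⟨_, hN.combination hN' hs ht hst, rfl, ?_⟩
    have : meanOfRows f hf _ (hN.combination hN' hs ht hst) =
      (s : ℂ) • meanOfRows f hf N hN + (t : ℂ) • meanOfRows f hf N' hN' := rfl
    rw [this, map_add, map_smul, map_smul, h, h']
    rfl
  have hull : convexHull ℝ (Set.range fun j : J => ⇑(evalMean j)) ⊆ H := by
    refine convexHull_min ?_ hH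
    rintro _ ⟨j, rfl⟩
    exact ⟨_, isMean_evalMean j, rfl, rfl⟩
  have hsub : H ⊆ means J := fun m ⟨N, hN, h, _⟩ => ⟨N, hN, h⟩
  have hdense : Dense ((↑) ⁻¹' H : Set (means J)) := fun m => by
    rw [Topology.IsInducing.subtypeVal.closure_eq_preimage_closure_image,
      Subtype.image_preimage_coe, Set.inter_eq_right.2 hsub]
    exact closure_mono hull (means_subset_closure_convexHull J m.2)
  have heq := h1.ext_on hdense h2 fun m ⟨N, hN, hNm, h⟩ => by
    obtain ⟨m, hm⟩ := m
    subst hNm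
    exact h
  exact congrFun heq ⟨_, N, hN, rfl⟩

theorem evalMean_injective (S : Type u) : Function.Injective fun s : S => ⇑(evalMean s) := by
  classical
  intro s t h
  by_contra hne
  have := congrFun h (toLInf (fun r => if r = s then 1 else 0) ⟨1, fun r => by split_ifs <;> simp⟩)
  change (if s = s then (1 : ℂ) else 0) = if t = s then 1 else 0 at this
  simp [Ne.symm hne] at this

/-- A matrix with the Fubini-like property extends to the product of the spaces of means. -/
theorem FubiniLike.hasAffineExtension {I : Type u} {J : Type v} {f : I → J → ℂ}
    {hf : IsBounded f} (h : FubiniLike f hf) : HasAffineExtension f := by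
  classical
  -- An arbitrary `y` need not give a bounded function of `i`; the default `0` is never met on
  -- means.
  let g : (LInf I → ℂ) → (LInf J → ℂ) → ℂ := fun x y =>
    if hy : ∃ C : ℝ, ∀ i, ‖y (row f hf i)‖ ≤ C then x (toLInf (fun i => y (row f hf i)) hy) else 0
  have hg : ∀ x (N : LInf J →ₗ[ℂ] ℂ) (hN : IsMean N), g x N = x (meanOfRows f hf N hN) :=
    fun x N hN => dif_pos _
  -- Exchanging the order turns `g M` into evaluation at a fixed element, hence continuous and
  -- affine in `y`.
  have hg' : ∀ (M : LInf I →ₗ[ℂ] ℂ) (hM : IsMean M), ∀ y ∈ means J,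
      g M y = y (meanOfCols f hf M hM) := by
    rintro M hM _ ⟨N, hN, rfl⟩
    rw [hg M N hN, h M hM N hN]
  refine ⟨LInf I → ℂ, inferInstance, inferInstance, inferInstance, inferInstance, inferInstance,
    inferInstance, inferInstance, LInf J → ℂ, inferInstance, inferInstance, inferInstance,
    inferInstance, inferInstance, inferInstance, inferInstance, means I, means J,
    fun i => evalMean i, fun j => evalMean j, g, isCompact_means I, convex_means I,
    isCompact_means J, convex_means J, evalMean_injective I,
    fun i => ⟨_, isMean_evalMean i, rfl⟩, evalMean_injective J,
    fun j => ⟨_, isMean_evalMean j, rfl⟩, fun i j => hg _ _ (isMean_evalMean j), ?_, ?_⟩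
  · rintro _ ⟨M, hM, rfl⟩
    refine ⟨(continuous_apply (meanOfCols f hf M hM)).continuousOn.congr (hg' M hM), ?_⟩
    intro x hx y hy s t hs ht hst
    simp only [hg' M hM _ hx, hg' M hM _ hy, hg' M hM _ (convex_means J hx hy hs ht hst),
      Pi.add_apply, Pi.smul_apply]
  · rintro _ ⟨N, hN, rfl⟩
    simp only [hg _ N hN]
    exact ⟨(continuous_apply _).continuousOn, fun _ _ _ _ _ _ _ _ _ => rfl⟩

end WeakMatrix

theorem theorem2 {I : Type u} {J : Type v}
    [TopologicalSpace I] [CompactSpace I] [T2Space I]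
    [TopologicalSpace J] [CompactSpace J] [T2Space J]
    (f : I → J → ℂ) (hf : WeakMatrix.IsBounded f)
    (hrow : ∀ i : I, Continuous fun j : J => f i j)
    (hcol : ∀ j : J, Continuous fun i : I => f i j) :
    WeakMatrix.IsWeaklyCompact f hf :=
  have h := WeakMatrix.fubiniLike_of_separately_continuous f hf hrow hcol
  ⟨h, h.hasAffineExtension,
    WeakMatrix.weaklyRelativelyCompact_range_col (fun j i => f i j) hf.swap hrow hcol,
    WeakMatrix.weaklyRelativelyCompact_range_col f hf hcol hrow⟩
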